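/- Let $(R,\mathfrak m,k)$ be a complete Noetherian local ring of Krull dimension $d$, let $E$ be an injective hull of $k$, and let $\omega\cong\operatorname{Hom}_R(H^d_{\mathfrak m}(R),E)$ be a canonical module of $R$. Let $B$ be a (not necessarily finitely generated) big Cohen–Macaulay $R$-module, i.e. an $R$-module on which every system of parameters of $R$ is a regular sequence. For $R$-modules $L\subseteq M$ put $$L^{\mathrm{cl}_B}_M=\{x\in M \mid b\otimes x\in\operatorname{im}(B\otimes_R L\to B\otimes_R M)\text{ for all } b\in B\};$$ this is a closure operation on $R$-modules. The ring $R$ is called $\mathrm{cl}_B$-rational if it is Cohen–Macaulay and $\tau_{\mathrm{cl}_B}(\omega)=\omega$, where $$\tau_{\mathrm{cl}_B}(\omega)=\operatorname{Ann}_\omega\bigl(0^{\mathrm{cl}_B}_{H^d_{\mathfrak m}(R)}\bigr)$$ is the set of elements of $\omega$ that, regarded as maps $H^d_{\mathfrak m}(R)\to E$, vanish on $0^{\mathrm{cl}_B}_{H^d_{\mathfrak m}(R)}$. Then $R$ is $\mathrm{cl}_B$-rational if and only if there is a system of parameters $x_1,\dots,x_d$ of $R$ such that the ideal $I=(x_1,\dots,x_d)$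 is $\mathrm{cl}_B$-closed, i.e. $I^{\mathrm{cl}_B}_R=I$. -/

import Mathlib

universe u v

open scoped TensorProduct

/-- A closure operation on the category of all `R`-modules: it sends every pair `N ⊆ M` to a
submodule `cl N` of `M`, and it is extensive, idempotent and order-preserving. -/
structure ModuleClosureOperation (R : Type u) [CommRing R] where
  cl : ∀ {M : Type u} [AddCommGroup M] [Module R M], Submodule R M → Submodule R M
  le_cl : ∀ {M : Type u} [AddCommGroup M] [Module R M] (N : Submodule R M), N ≤ cl N
  cl_cl : ∀ {M : Type u} [AddCommGroup M] [Module R M] (N : Submodule R M), cl (cl N) = cl N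
  cl_mono : ∀ {M : Type u} [AddCommGroup M] [Module R M] {N N' : Submodule R M},
    N ≤ N' → cl N ≤ cl N'

/-- The underlying map of the module closure `cl_B`: the closure of `L` in `M` is the set of all
`x ∈ M` such that `b ⊗ x` lies in the image of `B ⊗ L → B ⊗ M` for every `b ∈ B`. -/
def moduleClosureSubmodule {R : Type u} [CommRing R] (B : Type v) [AddCommGroup B] [Module R B]
    {M : Type u} [AddCommGroup M] [Module R M] (L : Submodule R M) : Submodule R M where
  carrier := {x | ∀ b : B, b ⊗ₜ[R] x ∈ LinearMap.range (L.subtype.lTensor B)}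
  add_mem' := by
    intro x y hx hy b
    rw [TensorProduct.tmul_add]
    exact Submodule.add_mem _ (hx b) (hy b)
  zero_mem' := by
    intro b
    rw [TensorProduct.tmul_zero]
    exact Submodule.zero_mem _
  smul_mem' := by
    intro r x hx b
    rw [TensorProduct.tmul_smul]
    exact Submodule.smul_mem _ r (hx b)

theorem moduleClosureSubmodule_le {R : Type u} [CommRing R] (B : Type v) [AddCommGroup B]
    [Module R B] {M : Type u} [AddCommGroup M] [Module R M] (L : Submodule R M) :
    L ≤ moduleClosureSubmodule B L := by
  intro x hx b
  exact ⟨b ⊗ₜ[R] ⟨x, hx⟩, by simp⟩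

theorem range_lTensor_moduleClosureSubmodule_le {R : Type u} [CommRing R] (B : Type v)
    [AddCommGroup B] [Module R B] {M : Type u} [AddCommGroup M] [Module R M]
    (N L : Submodule R M) (h : N ≤ moduleClosureSubmodule B L) :
    LinearMap.range (N.subtype.lTensor B) ≤ LinearMap.range (L.subtype.lTensor B) := by
  rintro _ ⟨t, rfl⟩
  induction t using TensorProduct.induction_on with
  | zero => rw [map_zero]; exact Submodule.zero_mem _
  | tmul b y =>
    rw [LinearMap.lTensor_tmul]
    exact h y.2 b
  | add s t hs ht => rw [map_add]; exact Submodule.add_mem _ hs ht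

/-- The module closure `cl_B` of an `R`-module `B`. -/
def moduleClosure (R : Type u) [CommRing R] (B : Type v) [AddCommGroup B] [Module R B] :
    ModuleClosureOperation R where
  cl L := moduleClosureSubmodule B L
  le_cl L := moduleClosureSubmodule_le B L
  cl_cl L := le_antisymm
    (fun _ hx b => range_lTensor_moduleClosureSubmodule_le B _ L le_rfl (hx b))
    (moduleClosureSubmodule_le B _)
  cl_mono h := fun _ hx b => range_lTensor_moduleClosureSubmodule_le B _ _
    (h.trans (moduleClosureSubmodule_le B _)) (hx b)

/-- A system of parameters of a Noetherian local ring `R`: a sequence of `dim R` elements that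
generates an ideal whose radical is the maximal ideal. -/
def IsSystemOfParameters {R : Type u} [CommRing R] [IsLocalRing R] (xs : List R) : Prop :=
  (xs.length : WithBot ℕ∞) = ringKrullDim R ∧
    (Ideal.ofList xs).radical = IsLocalRing.maximalIdeal R

/-- `R` is Cohen–Macaulay (for `R` Noetherian local): its depth is its dimension, i.e. the maximal
ideal contains a regular sequence on `R` of length `dim R`. -/
def IsCohenMacaulayLocal (R : Type u) [CommRing R] [IsLocalRing R] : Prop :=
  ∃ xs : List R, (∀ x ∈ xs, x ∈ IsLocalRing.maximalIdeal R) ∧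
    (xs.length : WithBot ℕ∞) = ringKrullDim R ∧ RingTheory.Sequence.IsRegular R xs

/-- `B` is a (balanced) big Cohen–Macaulay module over the Noetherian local ring `R`: every system
of parameters of `R` is a regular sequence on `B` (this includes `(x₁, …, x_d) B ≠ B`). -/
def IsBigCohenMacaulay (R : Type u) [CommRing R] [IsLocalRing R] (B : Type v) [AddCommGroup B]
    [Module R B] : Prop :=
  ∀ xs : List R, IsSystemOfParameters xs → RingTheory.Sequence.IsRegular B xs

/-- `E` is an injective hull of the residue field `k` of `R`: it is injective, and `k` embeds in it
as an essential submodule. -/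
structure IsInjectiveHullOfResidueField (R : Type u) [CommRing R] [IsLocalRing R]
    (E : Type u) [AddCommGroup E] [Module R E] : Prop where
  injective : Module.Injective R E
  essential : ∃ f : IsLocalRing.ResidueField R →ₗ[R] E, Function.Injective f ∧
    ∀ N : Submodule R E, N ⊓ LinearMap.range f = ⊥ → N = ⊥

/-- The top local cohomology module `H^d_m(R)`, where `m` is the maximal ideal of `R` and `d` is
the Krull dimension of `R` (a natural number, as `R` is to be Noetherian local). -/
noncomputable abbrev TopLocalCohomology (R : Type u) [CommRing R] [IsLocalRing R] : Type u :=
  (localCohomology (IsLocalRing.maximalIdeal R) ((ringKrullDim R).unbotD 0).toNat).obj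
    (ModuleCat.of R R)

/-- The presentation of `ω` as a canonical module of the complete local ring `R`: an isomorphism of
`ω` with the Matlis dual `Hom_R(H^d_m(R), E)` of the top local cohomology module. -/
abbrev CanonicalModuleIso (R : Type u) [CommRing R] [IsLocalRing R]
    (E : Type u) [AddCommGroup E] [Module R E] (ω : Type u) [AddCommGroup ω] [Module R ω] :
    Type u :=
  ω ≃ₗ[R] (TopLocalCohomology R →ₗ[R] E)

/-- `Ann_ω N` for a submodule `N` of `H^d_m(R)`: the elements of `ω` that kill `N` when they are
regarded as maps `H^d_m(R) → E`. -/
noncomputable def canonicalAnnihilator {R : Type u} [CommRing R] [IsLocalRing R]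
    {E : Type u} [AddCommGroup E] [Module R E] {ω : Type u} [AddCommGroup ω] [Module R ω]
    (ψ : CanonicalModuleIso R E ω) (N : Submodule R (TopLocalCohomology R)) : Submodule R ω where
  carrier := {w | ∀ η ∈ N, ψ w η = 0}
  add_mem' := by
    intro a b ha hb η hη
    rw [map_add, LinearMap.add_apply, ha η hη, hb η hη, add_zero]
  zero_mem' := by
    intro η _
    rw [map_zero, LinearMap.zero_apply]
  smul_mem' := by
    intro r a ha η hη
    rw [map_smul, LinearMap.smul_apply, ha η hη, smul_zero]

/-- The test submodule `τ_cl(ω) = Ann_ω (0^cl)`, where `0^cl` is the closure of the zero submodule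
in `H^d_m(R)`. -/
noncomputable def testSubmodule {R : Type u} [CommRing R] [IsLocalRing R] (c : ModuleClosureOperation R)
    {E : Type u} [AddCommGroup E] [Module R E] {ω : Type u} [AddCommGroup ω] [Module R ω]
    (ψ : CanonicalModuleIso R E ω) : Submodule R ω :=
  canonicalAnnihilator ψ (c.cl (⊥ : Submodule R (TopLocalCohomology R)))

/-- `R` is `cl`-rational: `R` is Cohen–Macaulay and `τ_cl(ω) = ω`. -/
def IsClRational {R : Type u} [CommRing R] [IsLocalRing R] (c : ModuleClosureOperation R)
    {E : Type u} [AddCommGroup E] [Module R E] {ω : Type u} [AddCommGroup ω] [Module R ω]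
    (ψ : CanonicalModuleIso R E ω) : Prop :=
  IsCohenMacaulayLocal R ∧ testSubmodule c ψ = ⊤

-- Let H be the top local cohomology of R. Maps into E separate the elements of H, so τ(ω) = ω says
-- exactly that 0^cl = 0 in H (`testSubmodule_eq_top_iff`). The rest hinges on one fact,
-- `exists_quotient_to_topLocalCohomology`: if a system of parameters xs is weakly regular on R, the
-- part of H killed by (xs) is a copy of R/(xs). It follows from H = colim Ext^d(R/m^t, R) and Rees'
-- isomorphism Ext^d(M, R) ≅ Hom(M, R/(ys)), natural in the M killed by ys. Local cohomology is
-- built from the derived functor `Ext`, while Rees' argument needs the exact sequences of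
-- `Abelian.Ext`, so the two are compared first, naturally in the first variable.
--
-- If 0^cl = 0 and r is in the closure of (xs), the class of r in R/(xs) is killed by every b ⊗ -.
-- So is its image in H, which is therefore zero; as R/(xs) embeds in H, r lies in (xs).
--
-- Conversely, let (xs) be closed. Regularity of xs on B and Nakayama make the ideals of all initial
-- segments closed, and this forces xs to be regular on R
-- (`IsBigCohenMacaulay.isWeaklyRegular_of_closed`). An element of 0^cl killed by (xs) is the class
-- of some r. The relation b ⊗ η = 0 already holds at a finite stage R/(x_i^{t+1}), where it gives
-- (x_1⋯x_d)^t r b ∈ (x_i^{t+1})B. Regularity on B then gives rb ∈ (xs)B for all b, so r ∈ (xs) and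
-- η = 0. Since H is m-power torsion, 0^cl = 0.

universe w

open CategoryTheory Limits Opposite

/-! ### Homology in the opposite of the module category, as cocycles modulo coboundaries -/

section OppositeHomology

variable {R : Type u} [CommRing R]

/-- The map from the dual of the opcycles of `K` to the dual of its degree `n` term. -/
noncomputable def opcyclesIncl (K : HomologicalComplex (ModuleCat.{v} R)ᵒᵖ (ComplexShape.down ℕ))
    (n : ℕ) : (K.opcycles n).unop →ₗ[R] (K.X n).unop :=
  (K.pOpcycles n).unop.hom

/-- The map from the dual of the opcycles of `K` to the dual of its homology. -/
noncomputable def opcyclesToHomology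
    (K : HomologicalComplex (ModuleCat.{v} R)ᵒᵖ (ComplexShape.down ℕ)) (n : ℕ) :
    (K.opcycles n).unop →ₗ[R] (K.homology n).unop :=
  (K.homologyι n).unop.hom

/-- The cocycles of degree `n` of the dual of `K`. -/
noncomputable def dualCocycles
    (K : HomologicalComplex (ModuleCat.{v} R)ᵒᵖ (ComplexShape.down ℕ)) (n : ℕ) :
    Submodule R (K.X n).unop :=
  LinearMap.ker (K.d (n + 1) n).unop.hom

variable (K L : HomologicalComplex (ModuleCat.{v} R)ᵒᵖ (ComplexShape.down ℕ)) (n : ℕ)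

theorem opcyclesIncl_injective : Function.Injective (opcyclesIncl K n) := by
  have : Mono (K.pOpcycles n).unop := inferInstance
  exact (ModuleCat.mono_iff_injective _).1 this

theorem opcyclesToHomology_surjective : Function.Surjective (opcyclesToHomology K n) := by
  have : Epi (K.homologyι n).unop := inferInstance
  exact (ModuleCat.epi_iff_surjective _).1 this

theorem range_opcyclesIncl : LinearMap.range (opcyclesIncl K n) = dualCocycles K n := by
  let S : ShortComplex (ModuleCat.{v} R)ᵒᵖ := ShortComplex.mk (K.d (n + 1) n) (K.pOpcycles n)
    (K.d_pOpcycles (n + 1) n)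
  have hS : S.Exact := S.exact_of_g_is_cokernel (K.opcyclesIsCokernel (n + 1) n (by simp))
  have := (ShortComplex.moduleCat_exact_iff_range_eq_ker _).1 hS.unop
  exact this

/-- Homology is the kernel of the map from opcycles to the next term; passing to the opposite turns
this into exactness at the cocycles. -/
theorem ker_opcyclesToHomology_succ (x : (K.opcycles (n + 1)).unop) :
    opcyclesToHomology K (n + 1) x = 0 ↔
      ∃ y : (K.X n).unop, (K.d (n + 1) n).unop.hom y = opcyclesIncl K (n + 1) x := by
  let S : ShortComplex (ModuleCat.{v} R)ᵒᵖ := ShortComplex.mk (K.homologyι (n + 1))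
    (K.fromOpcycles (n + 1) n) (K.homologyι_comp_fromOpcycles (n + 1) n)
  have hS : S.Exact := S.exact_of_f_is_kernel (K.homologyIsKernel (n + 1) n (by simp))
  have h := (ShortComplex.moduleCat_exact_iff_range_eq_ker _).1 hS.unop
  have h2 : x ∈ LinearMap.ker (opcyclesToHomology K (n + 1)) ↔
      x ∈ LinearMap.range (K.fromOpcycles (n + 1) n).unop.hom := by
    rw [show LinearMap.range (K.fromOpcycles (n + 1) n).unop.hom =
      LinearMap.ker (opcyclesToHomology K (n + 1)) from h]
  have h3 : ∀ y : (K.X n).unop, (K.d (n + 1) n).unop.hom y =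
      opcyclesIncl K (n + 1) ((K.fromOpcycles (n + 1) n).unop.hom y) := by
    intro y
    rw [← K.p_fromOpcycles (n + 1) n]
    rfl
  rw [LinearMap.mem_ker] at h2
  rw [h2]
  constructor
  · rintro ⟨y, rfl⟩
    exact ⟨y, h3 y⟩
  · rintro ⟨y, hy⟩
    exact ⟨y, opcyclesIncl_injective K (n + 1) ((h3 y).symm.trans hy)⟩

/-- No differential leaves degree 0, so there are no coboundaries to divide by. -/
theorem ker_opcyclesToHomology_zero (x : (K.opcycles 0).unop) :
    opcyclesToHomology K 0 x = 0 ↔ x = 0 := by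
  have : IsIso (K.homologyι 0) := K.isIso_homologyι 0 0 (by simp) (K.shape 0 0 (by simp))
  have : Mono (K.homologyι 0).unop := inferInstance
  exact map_eq_zero_iff _ ((ModuleCat.mono_iff_injective _).1 this)

/-- The class of a cocycle of the dual of `K` in the dual of the homology of `K`. -/
noncomputable def dualHomologyClass : dualCocycles K n →ₗ[R] (K.homology n).unop :=
  opcyclesToHomology K n ∘ₗ (LinearEquiv.ofInjective _ (opcyclesIncl_injective K n)).symm.toLinearMap
    ∘ₗ Submodule.inclusion (range_opcyclesIncl K n).ge

variable {K n} in
theorem exists_opcyclesIncl_eq (z : dualCocycles K n) :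
    ∃ x : (K.opcycles n).unop, opcyclesIncl K n x = z ∧
      dualHomologyClass K n z = opcyclesToHomology K n x := by
  refine ⟨(LinearEquiv.ofInjective _ (opcyclesIncl_injective K n)).symm
    (Submodule.inclusion (range_opcyclesIncl K n).ge z), ?_, rfl⟩
  have := LinearEquiv.apply_symm_apply (LinearEquiv.ofInjective _ (opcyclesIncl_injective K n))
    (Submodule.inclusion (range_opcyclesIncl K n).ge z)
  exact congrArg Subtype.val this

variable {K n} in
theorem dualHomologyClass_eq (z : dualCocycles K n) (x : (K.opcycles n).unop)
    (h : opcyclesIncl K n x = z) : dualHomologyClass K n z = opcyclesToHomology K n x := by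
  obtain ⟨y, hy, hy'⟩ := exists_opcyclesIncl_eq z
  rw [hy', opcyclesIncl_injective K n (hy.trans h.symm)]

theorem dualHomologyClass_surjective : Function.Surjective (dualHomologyClass K n) := by
  intro c
  obtain ⟨x, rfl⟩ := opcyclesToHomology_surjective K n c
  have hx : opcyclesIncl K n x ∈ dualCocycles K n := by
    rw [← range_opcyclesIncl]; exact ⟨x, rfl⟩
  exact ⟨⟨_, hx⟩, dualHomologyClass_eq _ x rfl⟩

variable {K} in
theorem dualHomologyClass_succ_eq_zero_iff (z : dualCocycles K (n + 1)) :
    dualHomologyClass K (n + 1) z = 0 ↔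
      ∃ y : (K.X n).unop, (K.d (n + 1) n).unop.hom y = z := by
  obtain ⟨x, hx, hx'⟩ := exists_opcyclesIncl_eq z
  rw [hx', ker_opcyclesToHomology_succ, hx]

variable {K} in
theorem dualHomologyClass_zero_eq_zero_iff (z : dualCocycles K 0) :
    dualHomologyClass K 0 z = 0 ↔ z = 0 := by
  obtain ⟨x, hx, hx'⟩ := exists_opcyclesIncl_eq z
  rw [hx', ker_opcyclesToHomology_zero, ← Subtype.coe_inj, ← hx]
  exact (map_eq_zero_iff _ (opcyclesIncl_injective K 0)).symm

variable {K L n} in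
theorem homologyMap_dualHomologyClass (φ : K ⟶ L) (z : dualCocycles L n) (z' : dualCocycles K n)
    (h : (φ.f n).unop.hom (z : (L.X n).unop) = z') :
    (HomologicalComplex.homologyMap φ n).unop.hom (dualHomologyClass L n z) =
      dualHomologyClass K n z' := by
  obtain ⟨x, hx, hx'⟩ := exists_opcyclesIncl_eq z
  rw [hx', dualHomologyClass_eq z' ((HomologicalComplex.opcyclesMap φ n).unop.hom x)]
  · have := congrArg Quiver.Hom.unop (HomologicalComplex.homologyι_naturality φ n)
    exact ConcreteCategory.congr_hom this x
  · rw [← h, ← hx]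
    have := congrArg Quiver.Hom.unop (HomologicalComplex.p_opcyclesMap φ n)
    exact ConcreteCategory.congr_hom this x

end OppositeHomology

/-! ### `Abelian.Ext` agrees with the derived functor `Ext` -/

section ExtComparison

variable {R : Type u} [CommRing R] {C : Type w} [Category.{v} C] [Abelian C] [Linear R C]

/-- The complex of modules of morphisms from a projective resolution, in the opposite category. -/
noncomputable abbrev resolutionHomComplex (R : Type u) [CommRing R] [Linear R C] {X : C}
    (P : ProjectiveResolution X) (Y : C) :
    HomologicalComplex (ModuleCat.{v} R)ᵒᵖ (ComplexShape.down ℕ) :=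
  (((linearYoneda R C).obj Y).rightOp.mapHomologicalComplex _).obj P.complex

theorem mem_dualCocycles_resolutionHomComplex {X : C} (P : ProjectiveResolution X) (Y : C) (n : ℕ)
    (f : P.complex.X n ⟶ Y) :
    f ∈ (dualCocycles (resolutionHomComplex R P Y) n) ↔ P.complex.d (n + 1) n ≫ f = 0 :=
  Iff.rfl

section

variable [HasExt.{u} C]

theorem extMk_zero_eq_zero {X Y : C} (P : ProjectiveResolution X)
    (f : P.complex.X 0 ⟶ Y) (hf : P.complex.d 1 0 ≫ f = 0)
    (h : P.extMk f 1 rfl hf = 0) : f = 0 := by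
  rw [← P.extEquivCohomologyClass.apply_eq_iff_eq,
    ProjectiveResolution.extEquivCohomologyClass_extMk,
    ProjectiveResolution.extEquivCohomologyClass_zero,
    CochainComplex.HomComplex.CohomologyClass.mk_eq_zero_iff,
    CochainComplex.HomComplex.Cocycle.toSingleMk_mem_coboundaries_iff _ _ _ _ _ 1 (by simp)] at h
  obtain ⟨g, hg⟩ := h
  -- A cobounding map would start in cochain degree 1, where the resolution vanishes.
  have h0 : IsZero (P.cochainComplex.X 1) := P.cochainComplex.isZero_of_isStrictlyLE 0 1 (by simp)
  rw [h0.eq_of_src g 0, comp_zero] at hg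
  rw [← cancel_epi (P.cochainComplexXIso (-(0 : ℕ)) 0 rfl).hom, comp_zero]
  exact hg.symm

theorem smul_extMk {X Y : C} (P : ProjectiveResolution X) {n : ℕ} (f : P.complex.X n ⟶ Y)
    (hf : P.complex.d (n + 1) n ≫ f = 0) (r : R) :
    r • P.extMk f (n + 1) rfl hf =
      P.extMk (r • f) (n + 1) rfl (by rw [Linear.comp_smul, hf, smul_zero]) := by
  rw [Abelian.Ext.smul_eq_comp_mk₀, P.extMk_comp_mk₀]
  congr 1
  rw [Linear.comp_smul, Category.comp_id]

/-- The class in `Abelian.Ext` of a cocycle on a projective resolution, as a linear map. -/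
noncomputable def abelianExtClass {X : C} (P : ProjectiveResolution X) (Y : C) (n : ℕ) :
    dualCocycles (resolutionHomComplex R P Y) n →ₗ[R] Abelian.Ext X Y n where
  toFun z := P.extMk (Y := Y) z.1 (n + 1) rfl z.2
  map_add' z z' := (P.add_extMk (Y := Y) z.1 z'.1 (n + 1) rfl z.2 z'.2).symm
  map_smul' r z := by
    exact (smul_extMk P (Y := Y) z.1 z.2 r).symm

theorem abelianExtClass_surjective {X : C} (P : ProjectiveResolution X) (Y : C) (n : ℕ) :
    Function.Surjective (abelianExtClass (R := R) P Y n) := by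
  intro α
  obtain ⟨f, hf, rfl⟩ := P.extMk_surjective α (n + 1) rfl
  exact ⟨⟨f, hf⟩, rfl⟩

end

variable [EnoughProjectives C]

/-- The class in Mathlib's derived functor `Ext` of a cocycle on a projective resolution. -/
noncomputable def derivedExtClass {X : C} (P : ProjectiveResolution X) (Y : C) (n : ℕ) :
    dualCocycles (resolutionHomComplex R P Y) n →ₗ[R] ((_root_.Ext R C n).obj (op X)).obj Y :=
  (P.isoLeftDerivedObj ((linearYoneda R C).obj Y).rightOp n).unop.hom.hom ∘ₗ
    dualHomologyClass (resolutionHomComplex R P Y) n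

theorem derivedExtClass_eq_zero_iff {X : C} (P : ProjectiveResolution X) (Y : C) (n : ℕ)
    (z : dualCocycles (resolutionHomComplex R P Y) n) :
    derivedExtClass P Y n z = 0 ↔ dualHomologyClass (resolutionHomComplex R P Y) n z = 0 := by
  refine map_eq_zero_iff
    (P.isoLeftDerivedObj ((linearYoneda R C).obj Y).rightOp n).unop.hom.hom ?_
  exact (ModuleCat.mono_iff_injective _).1 inferInstance

theorem derivedExtClass_surjective {X : C} (P : ProjectiveResolution X) (Y : C) (n : ℕ) :
    Function.Surjective (derivedExtClass (R := R) P Y n) := by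
  have : Function.Surjective
    (P.isoLeftDerivedObj ((linearYoneda R C).obj Y).rightOp n).unop.hom.hom :=
    (ModuleCat.epi_iff_surjective _).1 inferInstance
  exact this.comp (dualHomologyClass_surjective _ n)

theorem map_derivedExtClass {X X' : C} (P : ProjectiveResolution X) (P' : ProjectiveResolution X')
    (g : X' ⟶ X) (φ : P'.complex ⟶ P.complex) (comm : φ.f 0 ≫ P.π.f 0 = P'.π.f 0 ≫ g) (Y : C)
    (n : ℕ) (z : dualCocycles (resolutionHomComplex R P Y) n)
    (z' : dualCocycles (resolutionHomComplex R P' Y) n)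
    (h : z'.1 = φ.f n ≫ z.1) :
    (((_root_.Ext R C n).map g.op).app Y).hom (derivedExtClass P Y n z) =
      derivedExtClass P' Y n z' := by
  have h1 := homologyMap_dualHomologyClass (K := resolutionHomComplex R P' Y)
    (L := resolutionHomComplex R P Y)
    ((((linearYoneda R C).obj Y).rightOp.mapHomologicalComplex _).map φ) z z' h.symm
  have h2 := congrArg Quiver.Hom.unop (ProjectiveResolution.isoLeftDerivedObj_hom_naturality g P' P
    φ comm ((linearYoneda R C).obj Y).rightOp n)
  have h3 := ConcreteCategory.congr_hom h2 (dualHomologyClass (resolutionHomComplex R P Y) n z)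
  refine h3.trans ?_
  exact congrArg (P'.isoLeftDerivedObj ((linearYoneda R C).obj Y).rightOp n).unop.hom.hom h1

variable [HasExt.{u} C]

/-- Both kernels consist of the coboundaries of the same Hom complex, so both Ext modules are the
same quotient of its cocycles. -/
theorem ker_abelianExtClass {X : C} (P : ProjectiveResolution X) (Y : C) (n : ℕ) :
    LinearMap.ker (abelianExtClass (R := R) P Y n) =
      LinearMap.ker (derivedExtClass (R := R) P Y n) := by
  ext z
  rw [LinearMap.mem_ker, LinearMap.mem_ker, derivedExtClass_eq_zero_iff]
  cases n with
  | zero =>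
    rw [dualHomologyClass_zero_eq_zero_iff]
    constructor
    · intro h
      exact Subtype.ext (extMk_zero_eq_zero P (Y := Y) z.1 z.2 h)
    · rintro rfl
      exact map_zero _
  | succ n =>
    rw [dualHomologyClass_succ_eq_zero_iff]
    exact P.extMk_eq_zero_iff (Y := Y) z.1 (n + 2) rfl z.2 n rfl

/-- The comparison between `Abelian.Ext` and the derived functor `Ext`. -/
noncomputable def extComparison (R : Type u) [CommRing R] [Linear R C] (X Y : C) (n : ℕ) :
    Abelian.Ext X Y n ≃ₗ[R] ((_root_.Ext R C n).obj (op X)).obj Y :=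
  ((abelianExtClass (R := R) (projectiveResolution X) Y n).quotKerEquivOfSurjective
      (abelianExtClass_surjective _ Y n)).symm ≪≫ₗ
    Submodule.quotEquivOfEq _ _ (ker_abelianExtClass _ Y n) ≪≫ₗ
    (derivedExtClass (R := R) (projectiveResolution X) Y n).quotKerEquivOfSurjective
      (derivedExtClass_surjective _ Y n)

theorem extComparison_abelianExtClass {X Y : C} {n : ℕ}
    (z : dualCocycles (resolutionHomComplex R (projectiveResolution X) Y) n) :
    extComparison R X Y n (abelianExtClass (projectiveResolution X) Y n z) =
      derivedExtClass (projectiveResolution X) Y n z := by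
  have : ((abelianExtClass (R := R) (projectiveResolution X) Y n).quotKerEquivOfSurjective
      (abelianExtClass_surjective _ Y n)).symm (abelianExtClass (projectiveResolution X) Y n z) =
      Submodule.Quotient.mk z := by
    rw [LinearEquiv.symm_apply_eq]
    rfl
  rw [extComparison, LinearEquiv.trans_apply, LinearEquiv.trans_apply, this]
  rfl

/-- On both sides, pulling back along `g` is composing a cocycle with a lift of `g` to the
resolutions. This naturality is what lets the transition maps of local cohomology be read in
`Abelian.Ext`. -/
theorem extComparison_precomp {X X' Y : C} (g : X' ⟶ X) (n : ℕ) (α : Abelian.Ext X Y n) :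
    (((_root_.Ext R C n).map g.op).app Y).hom (extComparison R X Y n α) =
      extComparison R X' Y n ((Abelian.Ext.mk₀ g).comp α (zero_add n)) := by
  obtain ⟨z, rfl⟩ := abelianExtClass_surjective (R := R) (projectiveResolution X) Y n α
  have lift_comm : (ProjectiveResolution.lift g (projectiveResolution X')
      (projectiveResolution X)).f 0 ≫ (projectiveResolution X).π.f 0 =
      (projectiveResolution X').π.f 0 ≫ g :=
    ProjectiveResolution.lift_commutes_zero g _ _
  let φ : ProjectiveResolution.Hom (projectiveResolution X') (projectiveResolution X) g :=
    { hom := ProjectiveResolution.lift g _ _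
      hom_f_zero_comp_π_f_zero := by
        rw [ChainComplex.single₀_map_f_zero]
        exact lift_comm }
  rw [extComparison_abelianExtClass]
  have h := ProjectiveResolution.mk₀_comp_extMk (Y := Y) z.1 (n + 1) rfl z.2 φ
  refine (map_derivedExtClass (projectiveResolution X) (projectiveResolution X') g φ.hom
    lift_comm Y n z ⟨φ.hom.f n ≫ z.1, ?_⟩ rfl).trans ?_
  · refine (mem_dualCocycles_resolutionHomComplex _ Y n _).2 ?_
    refine (Category.assoc _ _ _).symm.trans ?_
    rw [← φ.hom.comm]
    exact (Category.assoc _ _ _).trans ((congrArg _ z.2).trans comp_zero)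
  · rw [← extComparison_abelianExtClass]
    exact congrArg (extComparison R X' Y n) h.symm

end ExtComparison

/-! ### Local cohomology as a filtered colimit of Ext(R/I^t, N), elementwise -/

section LocalCohomologyPresentation

variable {R : Type u} [CommRing R]

/-- The projection `R ⧸ L → R ⧸ K` for `L ≤ K`. -/
noncomputable abbrev quotientProj {L K : Ideal R} (h : L ≤ K) :
    ModuleCat.of R (R ⧸ L) ⟶ ModuleCat.of R (R ⧸ K) :=
  ModuleCat.ofHom (Submodule.mapQ L K LinearMap.id h)

theorem quotientProj_comp {L K J : Ideal R} (h : L ≤ K) (h' : K ≤ J) :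
    quotientProj h ≫ quotientProj h' = quotientProj (h.trans h') := by
  ext; rfl

/-- The module `Ext^n(R/K, N)`. -/
abbrev QuotientExt (K : Ideal R) (N : ModuleCat.{u} R) (n : ℕ) : Type u :=
  Abelian.Ext.{u} (ModuleCat.of R (R ⧸ K)) N n

/-- The map `Ext^n(R/K, N) → Ext^n(R/L, N)` for `L ≤ K`. -/
noncomputable def quotientExtRes {L K : Ideal R} (h : L ≤ K) (N : ModuleCat.{u} R) (n : ℕ) :
    QuotientExt K N n →ₗ[R] QuotientExt L N n where
  toFun α := (Abelian.Ext.mk₀ (quotientProj h)).comp α (zero_add n)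
  map_add' _ _ := Abelian.Ext.comp_add _ _ _ _
  map_smul' _ _ := Abelian.Ext.comp_smul _ _ _ _

theorem quotientExtRes_quotientExtRes {L K J : Ideal R} (h : L ≤ K) (h' : K ≤ J)
    (N : ModuleCat.{u} R) (n : ℕ) (α : QuotientExt J N n) :
    quotientExtRes h N n (quotientExtRes h' N n α) = quotientExtRes (h.trans h') N n α := by
  simp only [quotientExtRes, LinearMap.coe_mk, AddHom.coe_mk]
  rw [Abelian.Ext.mk₀_comp_mk₀_assoc, quotientProj_comp]

/-- The cocone that presents local cohomology as a colimit. -/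
noncomputable def localCohomologyCocone (I : Ideal R) (n : ℕ) :
    Cocone (localCohomology.diagram (localCohomology.idealPowersDiagram I) n) where
  pt := localCohomology I n
  ι := (colimit.cocone (localCohomology.diagram (localCohomology.idealPowersDiagram I) n)).ι

/-- Local cohomology is the colimit of the `Ext`-modules that define it. -/
noncomputable def localCohomologyCoconeIsColimit (I : Ideal R) (n : ℕ) (N : ModuleCat.{u} R) :
    IsColimit (((evaluation _ _).obj N).mapCocone (localCohomologyCocone I n)) :=
  isColimitOfPreserves ((evaluation _ _).obj N)
    (colimit.isColimit (localCohomology.diagram (localCohomology.idealPowersDiagram I) n))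

/-- The map from `Ext^n(R/I^t, N)` to local cohomology. -/
noncomputable def toLocalCohomology (I : Ideal R) (n : ℕ) (N : ModuleCat.{u} R) (t : ℕ) :
    QuotientExt (I ^ t) N n →ₗ[R] (localCohomology I n).obj N :=
  (((localCohomologyCocone I n).ι.app (op (op t))).app N).hom ∘ₗ
    (extComparison R (ModuleCat.of R (R ⧸ I ^ t)) N n).toLinearMap

theorem toLocalCohomology_quotientExtRes (I : Ideal R) (n : ℕ) (N : ModuleCat.{u} R) {t s : ℕ}
    (h : t ≤ s) (α : QuotientExt (I ^ t) N n) :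
    toLocalCohomology I n N s (quotientExtRes (Ideal.pow_le_pow_right h) N n α) =
      toLocalCohomology I n N t α := by
  have h1 := congrArg (fun f => f.app N)
    ((localCohomologyCocone I n).w (homOfLE h).op.op)
  have h2 := ConcreteCategory.congr_hom h1 (extComparison R (ModuleCat.of R (R ⧸ I ^ t)) N n α)
  refine Eq.trans ?_ h2
  refine congrArg (((localCohomologyCocone I n).ι.app (op (op s))).app N).hom ?_
  exact (extComparison_precomp (R := R) (quotientProj (Ideal.pow_le_pow_right h)) n α).symm

instance preservesColimit_localCohomologyDiagram (I : Ideal R) (n : ℕ) (N : ModuleCat.{u} R) :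
    PreservesColimit (localCohomology.diagram (localCohomology.idealPowersDiagram I) n ⋙
      (evaluation _ _).obj N) (forget (ModuleCat.{u} R)) := by
  have : PreservesFilteredColimitsOfSize.{0, 0} (forget (ModuleCat.{u} R)) :=
    preservesFilteredColimitsOfSize_shrink.{0, u, 0, u} _
  have := PreservesFilteredColimitsOfSize.preserves_filtered_colimits
    (F := forget (ModuleCat.{u} R)) (ℕᵒᵖᵒᵖ)
  infer_instance

theorem exists_toLocalCohomology_eq (I : Ideal R) (n : ℕ) (N : ModuleCat.{u} R)
    (η : (localCohomology I n).obj N) :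
    ∃ t α, toLocalCohomology I n N t α = η := by
  obtain ⟨j, y, hy⟩ := Concrete.isColimit_exists_rep _ (localCohomologyCoconeIsColimit I n N) η
  refine ⟨j.unop.unop, (extComparison R _ N n).symm y, ?_⟩
  refine Eq.trans ?_ hy
  exact congrArg (((localCohomologyCocone I n).ι.app j).app N).hom
    ((extComparison R (ModuleCat.of R (R ⧸ I ^ j.unop.unop)) N n).apply_symm_apply y)

theorem exists_quotientExtRes_eq_zero (I : Ideal R) (n : ℕ) (N : ModuleCat.{u} R) {t : ℕ}
    (α : QuotientExt (I ^ t) N n) (hα : toLocalCohomology I n N t α = 0) :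
    ∃ (s : ℕ) (h : t ≤ s), quotientExtRes (Ideal.pow_le_pow_right h) N n α = 0 := by
  obtain ⟨j, f, g, hfg⟩ := Concrete.isColimit_exists_of_rep_eq _
    (localCohomologyCoconeIsColimit I n N) (i := op (op t)) (j := op (op t))
    (extComparison R (ModuleCat.of R (R ⧸ I ^ t)) N n α) 0
    (hα.trans (map_zero (((localCohomologyCocone I n).ι.app (op (op t))).app N).hom).symm)
  have h : t ≤ j.unop.unop := leOfHom f.unop.unop
  refine ⟨j.unop.unop, h, ?_⟩
  apply (extComparison R _ N n).injective
  rw [map_zero]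
  refine (extComparison_precomp (R := R) (quotientProj (Ideal.pow_le_pow_right h)) n α).symm.trans ?_
  exact hfg.trans (map_zero (((localCohomology.diagram
    (localCohomology.idealPowersDiagram I) n).map g).app N).hom)

end LocalCohomologyPresentation

/-! ### Rees' theorem on Ext and regular sequences -/

section Rees

variable {R : Type u} [CommRing R]

open RingTheory.Sequence Pointwise

/-- Postcomposition with a linear equivalence. -/
def homCongrRight (M : Type*) {A B : Type*} [AddCommGroup M] [Module R M] [AddCommGroup A]
    [Module R A] [AddCommGroup B] [Module R B] (q : A ≃ₗ[R] B) : (M →ₗ[R] A) ≃ₗ[R] (M →ₗ[R] B) :=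
  LinearEquiv.congrRight q

theorem smul_ext_eq_zero {M N : ModuleCat.{u} R} {x : R} (hx : ∀ m : M, x • m = 0) {n : ℕ}
    (α : Abelian.Ext.{u} M N n) : x • α = 0 := by
  have h : x • 𝟙 M = 0 := by
    ext m
    exact hx m
  rw [← Abelian.Ext.mk₀_id_comp α, ← Abelian.Ext.smul_comp, ← Abelian.Ext.mk₀_smul, h,
    Abelian.Ext.mk₀_zero, Abelian.Ext.zero_comp]

/-- The connecting map `Ext^n(M, N/xN) → Ext^{n+1}(M, N)` for an `N`-regular element `x`. -/
noncomputable def extConnecting {x : R} {N : ModuleCat.{u} R} (hx : IsSMulRegular N x)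
    (M : ModuleCat.{u} R) (n : ℕ) :
    Abelian.Ext.{u} M (ModuleCat.of R (QuotSMulTop x N)) n →ₗ[R] Abelian.Ext.{u} M N (n + 1) where
  toFun α := α.comp hx.smulShortComplex_shortExact.extClass rfl
  map_add' _ _ := Abelian.Ext.add_comp _ _ _ _
  map_smul' _ _ := Abelian.Ext.smul_comp _ _ _ _

theorem extConnecting_precomp {x : R} {N : ModuleCat.{u} R} (hx : IsSMulRegular N x)
    {M M' : ModuleCat.{u} R} (g : M' ⟶ M) (n : ℕ)
    (α : Abelian.Ext.{u} M (ModuleCat.of R (QuotSMulTop x N)) n) :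
    extConnecting hx M' n ((Abelian.Ext.mk₀ g).comp α (zero_add n)) =
      (Abelian.Ext.mk₀ g).comp (extConnecting hx M n α) (zero_add (n + 1)) := by
  exact Abelian.Ext.comp_assoc _ _ _ (zero_add n) rfl (by omega)

/-- The next map in the long exact sequence is multiplication by `x`, which is zero on Ext since `x`
kills `M`. -/
theorem extConnecting_surjective {x : R} {N : ModuleCat.{u} R} (hx : IsSMulRegular N x)
    {M : ModuleCat.{u} R} (hM : ∀ m : M, x • m = 0) (n : ℕ) :
    Function.Surjective (extConnecting hx M n) := by
  intro α
  obtain ⟨β, hβ⟩ := Abelian.Ext.covariant_sequence_exact₁ (X := M) hx.smulShortComplex_shortExact α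
    (by
      have := smul_ext_eq_zero hM α
      rw [Abelian.Ext.smul_eq_comp_mk₀] at this
      exact this) rfl
  exact ⟨β, hβ⟩

theorem extConnecting_injective {x : R} {N : ModuleCat.{u} R} (hx : IsSMulRegular N x)
    (M : ModuleCat.{u} R) (n : ℕ) [Subsingleton (Abelian.Ext.{u} M N n)] :
    Function.Injective (extConnecting hx M n) := by
  rw [injective_iff_map_eq_zero]
  intro α hα
  obtain ⟨β, hβ⟩ := Abelian.Ext.covariant_sequence_exact₃ (X := M) hx.smulShortComplex_shortExact α
    rfl hα
  have : β = 0 := Subsingleton.elim (α := Abelian.Ext.{u} M N n) β 0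
  rw [← hβ, this, Abelian.Ext.zero_comp]
  rfl

/-- Dimension shifting: Ext^{i+1}(M, N) is a quotient of Ext^i(M, N/xN). In degree 0, a map from a
module killed by `x` to one on which `x` is regular vanishes. -/
theorem subsingleton_ext_of_isWeaklyRegular (xs : List R) :
    ∀ (N M : ModuleCat.{u} R), IsWeaklyRegular N xs → (∀ x ∈ xs, ∀ m : M, x • m = 0) →
      ∀ i < xs.length, Subsingleton (Abelian.Ext.{u} M N i) := by
  induction xs with
  | nil => intro N M _ _ i hi; simp at hi
  | cons x xs ih =>
    intro N M hN hM i hi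
    obtain ⟨hx, hN'⟩ := (isWeaklyRegular_cons_iff _ _ _).1 hN
    cases i with
    | zero =>
      refine (Abelian.Ext.addEquiv₀ (X := M) (Y := N)).toEquiv.subsingleton_congr.2
        ⟨fun f g => ?_⟩
      ext m
      refine hx ?_
      change x • f.hom m = x • g.hom m
      rw [← map_smul, ← map_smul, hM x List.mem_cons_self, map_zero, map_zero]
    | succ i =>
      have := ih (ModuleCat.of R (QuotSMulTop x N)) M hN' (fun y hy => hM y (List.mem_cons_of_mem _ hy))
        i (by simpa using hi)
      exact (extConnecting_surjective hx (hM x List.mem_cons_self) i).subsingleton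

/-- Rees' theorem: if `xs` is weakly regular on `N`, then `Ext^n(M, N)` for `n` the length of `xs`
is `Hom(M, N/(xs)N)`, naturally in the modules `M` that are killed by `xs`. -/
theorem exists_extEquiv_hom_quotient (xs : List R) :
    ∀ N : ModuleCat.{u} R, IsWeaklyRegular N xs →
      ∃ e : ∀ M : ModuleCat.{u} R, (∀ x ∈ xs, ∀ m : M, x • m = 0) →
        (Abelian.Ext.{u} M N xs.length ≃ₗ[R] (M →ₗ[R] N ⧸ (Ideal.ofList xs • ⊤ : Submodule R N))),
        ∀ (M M' : ModuleCat.{u} R) (hM) (hM') (g : M' ⟶ M) (α : Abelian.Ext.{u} M N xs.length),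
          e M' hM' ((Abelian.Ext.mk₀ g).comp α (zero_add _)) = e M hM α ∘ₗ g.hom := by
  induction xs with
  | nil =>
    intro N _
    let q : N ≃ₗ[R] N ⧸ (Ideal.ofList ([] : List R) • ⊤ : Submodule R N) :=
      (Submodule.quotEquivOfEqBot _ (by
        rw [Ideal.ofList_nil]
        exact Submodule.bot_smul (R := R) (M := N) _)).symm
    refine ⟨fun M _ => (Abelian.Ext.linearEquiv₀ (R := R) (X := M) (Y := N)) ≪≫ₗ
      (ModuleCat.homLinearEquiv (S := R)) ≪≫ₗ
      homCongrRight M q, fun M M' hM hM' g α => ?_⟩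
    obtain ⟨f, rfl⟩ := (Abelian.Ext.linearEquiv₀ (R := R)).symm.surjective α
    have key : ∀ (M : ModuleCat.{u} R) (f : M ⟶ N),
        Abelian.Ext.linearEquiv₀ (R := R) (Abelian.Ext.mk₀ f) = f :=
      fun M f => (Abelian.Ext.linearEquiv₀ (R := R)).apply_symm_apply f
    ext m
    simp only [Abelian.Ext.linearEquiv₀_symm_apply, Abelian.Ext.mk₀_comp_mk₀, LinearEquiv.trans_apply, key]
    rfl
  | cons x xs ih =>
    intro N hN
    obtain ⟨hx, hN'⟩ := (isWeaklyRegular_cons_iff _ _ _).1 hN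
    obtain ⟨e, he⟩ := ih (ModuleCat.of R (QuotSMulTop x N)) hN'
    let q : (QuotSMulTop x N ⧸ (Ideal.ofList xs • ⊤ : Submodule R (QuotSMulTop x N))) ≃ₗ[R]
        N ⧸ (Ideal.ofList (x :: xs) • ⊤ : Submodule R N) :=
      (Submodule.quotOfListConsSMulTopEquivQuotSMulTopInner N x xs).symm
    -- Injectivity is the vanishing of Ext one degree below the length; surjectivity holds because
    -- `x` kills `M`.
    have key : ∀ M : ModuleCat.{u} R, (∀ y ∈ x :: xs, ∀ m : M, y • m = 0) →
        Function.Bijective (extConnecting hx M xs.length) := fun M hM => ⟨by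
      have := subsingleton_ext_of_isWeaklyRegular (x :: xs) N M hN hM xs.length (by simp)
      exact extConnecting_injective hx M _, extConnecting_surjective hx (hM x List.mem_cons_self) _⟩
    let δ : ∀ M : ModuleCat.{u} R, (∀ y ∈ x :: xs, ∀ m : M, y • m = 0) →
        (Abelian.Ext.{u} M (ModuleCat.of R (QuotSMulTop x N)) xs.length ≃ₗ[R]
          Abelian.Ext.{u} M N (x :: xs).length) := fun M hM =>
      LinearEquiv.ofBijective (extConnecting hx M xs.length) (key M hM)
    let c : ∀ M : ModuleCat.{u} R, (M →ₗ[R] (QuotSMulTop x N ⧸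
        (Ideal.ofList xs • ⊤ : Submodule R (QuotSMulTop x N)))) ≃ₗ[R]
        (M →ₗ[R] N ⧸ (Ideal.ofList (x :: xs) • ⊤ : Submodule R N)) :=
      fun M => homCongrRight M q
    refine ⟨fun M hM => ((δ M hM).symm.trans
      (e M (fun y hy => hM y (List.mem_cons_of_mem _ hy)))).trans (c M), fun M M' hM hM' g α => ?_⟩
    obtain ⟨β, rfl⟩ := (δ M hM).surjective α
    have h1 : (Abelian.Ext.mk₀ g).comp (δ M hM β) (zero_add _) =
        δ M' hM' ((Abelian.Ext.mk₀ g).comp β (zero_add _)) :=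
      (extConnecting_precomp hx g _ β).symm
    rw [h1]
    have h2 := LinearEquiv.symm_apply_apply (δ M hM) β
    have h3 := LinearEquiv.symm_apply_apply (δ M' hM') ((Abelian.Ext.mk₀ g).comp β (zero_add _))
    change c M' (e M' _ ((δ M' hM').symm (δ M' hM' _))) =
      c M (e M _ ((δ M hM).symm (δ M hM β))) ∘ₗ g.hom
    rw [h2, h3, he M M' _ _ g β]
    rfl

end Rees

/-! ### The part of local cohomology killed by a regular sequence -/

section TopLocalCohomologyStructure

open RingTheory.Sequence

variable {R : Type u} [CommRing R]

theorem ideal_smul_quotient_eq_zero {K : Ideal R} {r : R} (hr : r ∈ K) (m : R ⧸ K) : r • m = 0 := by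
  obtain ⟨a, rfl⟩ := Ideal.Quotient.mk_surjective m
  rw [← Ideal.Quotient.mk_eq_mk, ← Submodule.Quotient.mk_smul, Submodule.Quotient.mk_eq_zero]
  exact K.mul_mem_right a hr

theorem exists_pow_smul_eq_zero (I : Ideal R) (n : ℕ) (N : ModuleCat.{u} R)
    (η : (localCohomology I n).obj N) : ∃ t, ∀ r ∈ I ^ t, r • η = 0 := by
  obtain ⟨t, α, rfl⟩ := exists_toLocalCohomology_eq I n N η
  refine ⟨t, fun r hr => ?_⟩
  rw [← map_smul, smul_ext_eq_zero (fun m => ideal_smul_quotient_eq_zero hr m), map_zero]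

variable {xs : List R}

theorem ofList_smul_quotient_eq_zero {K : Ideal R} (h : Ideal.ofList xs ≤ K) :
    ∀ x ∈ xs, ∀ m : R ⧸ K, x • m = 0 :=
  fun _ hx m => ideal_smul_quotient_eq_zero (h (Ideal.subset_span hx)) m

/-- Through Rees' isomorphism the map is precomposition with the surjection R/L → R/K. -/
theorem quotientExtRes_injective (hxs : IsWeaklyRegular R xs) {L K : Ideal R}
    (hL : Ideal.ofList xs ≤ L) (h : L ≤ K) :
    Function.Injective (quotientExtRes h (ModuleCat.of R R) xs.length) := by
  obtain ⟨e, he⟩ := exists_extEquiv_hom_quotient xs (ModuleCat.of R R) hxs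
  rw [injective_iff_map_eq_zero]
  intro α hα
  have h1 := he _ _ (ofList_smul_quotient_eq_zero (hL.trans h)) (ofList_smul_quotient_eq_zero hL)
    (quotientProj h) α
  refine (e (ModuleCat.of R (R ⧸ K))
    (ofList_smul_quotient_eq_zero (hL.trans h))).map_eq_zero_iff.1 ?_
  have h2 : (Abelian.Ext.mk₀ (quotientProj h)).comp α (zero_add _) = 0 := hα
  rw [h2, map_zero] at h1
  refine LinearMap.ext fun m => ?_
  obtain ⟨a, rfl⟩ := Ideal.Quotient.mk_surjective m
  exact (LinearMap.congr_fun h1 (Ideal.Quotient.mk L a)).symm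

/-- Through Rees' isomorphism, a map out of R/L killed by `K` factors through R/K. -/
theorem exists_quotientExtRes_eq (hxs : IsWeaklyRegular R xs) {L K : Ideal R}
    (hL : Ideal.ofList xs ≤ L) (h : L ≤ K) (α : QuotientExt L (ModuleCat.of R R) xs.length)
    (hα : ∀ k ∈ K, k • α = 0) :
    ∃ β, quotientExtRes h (ModuleCat.of R R) xs.length β = α := by
  obtain ⟨e, he⟩ := exists_extEquiv_hom_quotient xs (ModuleCat.of R R) hxs
  let f := e (ModuleCat.of R (R ⧸ L)) (ofList_smul_quotient_eq_zero hL) α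
  have hf : K ≤ LinearMap.ker (f ∘ₗ L.mkQ) := by
    intro k hk
    have h1 : k • f = 0 := by rw [← map_smul, hα k hk, map_zero]
    have h2 := LinearMap.congr_fun h1 (Ideal.Quotient.mk L 1)
    rw [LinearMap.smul_apply, ← map_smul] at h2
    rw [LinearMap.mem_ker, LinearMap.comp_apply]
    refine Eq.trans (congrArg f ?_) h2
    change Ideal.Quotient.mk L k = Ideal.Quotient.mk L (k * 1)
    rw [mul_one]
  refine ⟨(e (ModuleCat.of R (R ⧸ K)) (ofList_smul_quotient_eq_zero (hL.trans h))).symm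
    (K.liftQ (f ∘ₗ L.mkQ) hf), ?_⟩
  apply (e (ModuleCat.of R (R ⧸ L)) (ofList_smul_quotient_eq_zero hL)).injective
  refine (he _ _ (ofList_smul_quotient_eq_zero (hL.trans h)) (ofList_smul_quotient_eq_zero hL)
    (quotientProj h) _).trans ?_
  rw [LinearEquiv.apply_symm_apply]
  refine LinearMap.ext fun m => ?_
  obtain ⟨a, rfl⟩ := Ideal.Quotient.mk_surjective m
  rfl

/-- A linear endomorphism of `R ⧸ K` is determined by its value at `1`. -/
noncomputable def quotientHomEquivSelf (K : Ideal R) : (R ⧸ K →ₗ[R] R ⧸ K) ≃ₗ[R] R ⧸ K :=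
  LinearEquiv.ofBijective
    ({ toFun := fun f => f (Ideal.Quotient.mk K 1)
       map_add' := fun _ _ => rfl
       map_smul' := fun _ _ => rfl } : (R ⧸ K →ₗ[R] R ⧸ K) →ₗ[R] R ⧸ K) (by
    have key : ∀ a, Ideal.Quotient.mk K a = a • (Ideal.Quotient.mk K 1 : R ⧸ K) := fun a => by
      rw [map_one, Algebra.smul_def, mul_one]; rfl
    constructor
    · intro f g hfg
      ext
      change f (Ideal.Quotient.mk K 1) = g (Ideal.Quotient.mk K 1)
      exact hfg
    · intro b
      refine ⟨LinearMap.mulLeft R b, ?_⟩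
      change b * Ideal.Quotient.mk K 1 = b
      rw [map_one, mul_one])

theorem nonempty_quotientExt_equiv (hxs : IsWeaklyRegular R xs) :
    Nonempty ((R ⧸ Ideal.ofList xs) ≃ₗ[R]
      QuotientExt (Ideal.ofList xs) (ModuleCat.of R R) xs.length) := by
  obtain ⟨e, -⟩ := exists_extEquiv_hom_quotient xs (ModuleCat.of R R) hxs
  let q : (R ⧸ (Ideal.ofList xs • ⊤ : Ideal R)) ≃ₗ[R] R ⧸ Ideal.ofList xs :=
    Submodule.quotEquivOfEq _ _ (by rw [smul_eq_mul, Ideal.mul_top])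
  exact ⟨((e (ModuleCat.of R (R ⧸ Ideal.ofList xs)) (ofList_smul_quotient_eq_zero le_rfl)).trans
    ((homCongrRight (R ⧸ Ideal.ofList xs) q).trans (quotientHomEquivSelf _))).symm⟩

/-- If `R` has regular sequences of length `n` inside all powers of `I`, and `xs` is a regular
sequence of length `n` whose ideal contains a power of `I`, then the submodule of `H^n_I(R)` killed
by `xs` is isomorphic to `R ⧸ (xs)`. -/
theorem exists_quotient_to_localCohomology (I : Ideal R) (n : ℕ)
    (hI : ∀ t, ∃ ys : List R, IsWeaklyRegular R ys ∧ ys.length = n ∧ Ideal.ofList ys ≤ I ^ t)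
    (hxs : IsWeaklyRegular R xs) (hn : xs.length = n) {t : ℕ} (ht : I ^ t ≤ Ideal.ofList xs) :
    ∃ u : (R ⧸ Ideal.ofList xs) →ₗ[R] (localCohomology I n).obj (ModuleCat.of R R),
      Function.Injective u ∧
        ∀ η, (∃ a, u a = η) ↔ ∀ k ∈ Ideal.ofList xs, k • η = 0 := by
  subst hn
  obtain ⟨c⟩ := nonempty_quotientExt_equiv hxs
  have res_inj : ∀ (s : ℕ) {K : Ideal R} (h : I ^ s ≤ K),
      Function.Injective (quotientExtRes h (ModuleCat.of R R) xs.length) := by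
    intro s K h
    obtain ⟨ys, hys, hlen, hle⟩ := hI s
    rw [← hlen]
    exact quotientExtRes_injective hys hle h
  -- All transition maps are injective, hence so are the maps to the colimit.
  have to_inj : ∀ s, Function.Injective
      (toLocalCohomology I xs.length (ModuleCat.of R R) s) := by
    intro s
    rw [injective_iff_map_eq_zero]
    intro α hα
    obtain ⟨s', hs', h⟩ := exists_quotientExtRes_eq_zero I _ _ α hα
    exact (map_eq_zero_iff _ (res_inj s' _)).1 h
  let ρ := quotientExtRes ht (ModuleCat.of R R) xs.length
  refine ⟨toLocalCohomology I xs.length (ModuleCat.of R R) t ∘ₗ ρ ∘ₗ c.toLinearMap,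
    (to_inj t).comp ((res_inj t ht).comp c.injective), fun η => ⟨?_, fun hη => ?_⟩⟩
  · rintro ⟨a, rfl⟩ k hk
    rw [← map_smul, ideal_smul_quotient_eq_zero hk, map_zero]
  · obtain ⟨s, α, rfl⟩ := exists_toLocalCohomology_eq I _ _ η
    obtain ⟨α', hα'⟩ : ∃ α', toLocalCohomology I xs.length (ModuleCat.of R R) (max s t) α' =
        toLocalCohomology I xs.length (ModuleCat.of R R) s α :=
      ⟨_, toLocalCohomology_quotientExtRes I _ _ (le_max_left s t) α⟩
    rw [← hα'] at hη ⊢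
    have h1 : ∀ k ∈ Ideal.ofList xs, k • α' = 0 := fun k hk =>
      to_inj _ (by rw [map_smul, hη k hk, map_zero])
    have hle : I ^ (max s t) ≤ Ideal.ofList xs :=
      (Ideal.pow_le_pow_right (le_max_right s t)).trans ht
    obtain ⟨β, rfl⟩ : ∃ β, quotientExtRes hle (ModuleCat.of R R) xs.length β = α' := by
      -- Factoring through R/(xs) needs Rees' isomorphism for a sequence that kills R/I^(max s t);
      -- `xs` need not, so `ys` of the same length replaces it.
      obtain ⟨ys, hys, hlen, hys'⟩ := hI (max s t)
      generalize xs.length = n at *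
      subst hlen
      exact exists_quotientExtRes_eq hys hys' hle α' h1
    obtain ⟨a, rfl⟩ := c.surjective β
    refine ⟨a, ?_⟩
    refine (toLocalCohomology_quotientExtRes I _ _ (le_max_right s t) _).symm.trans ?_
    exact congrArg _ (quotientExtRes_quotientExtRes _ ht _ _ _)

end TopLocalCohomologyStructure

/-! ### Systems of parameters on B, and regularity on R from closedness -/

section BigCohenMacaulay

open RingTheory.Sequence IsLocalRing

variable {R : Type u} [CommRing R]

theorem mem_moduleClosureSubmodule_ideal {B : Type v} [AddCommGroup B] [Module R B] {J : Ideal R}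
    {r : R} : r ∈ moduleClosureSubmodule B J ↔ ∀ b : B, r • b ∈ (J • ⊤ : Submodule R B) := by
  refine forall_congr' fun b => ⟨?_, fun h => ?_⟩
  · rintro ⟨t, ht⟩
    have h1 : ∀ t : B ⊗[R] J, TensorProduct.rid R B (J.subtype.lTensor B t) ∈
        (J • ⊤ : Submodule R B) := by
      intro t
      induction t using TensorProduct.induction_on with
      | zero => rw [map_zero, map_zero]; exact Submodule.zero_mem _
      | tmul b j =>
        rw [LinearMap.lTensor_tmul, TensorProduct.rid_tmul]
        exact Submodule.smul_mem_smul j.2 trivial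
      | add s t hs ht => rw [map_add, map_add]; exact Submodule.add_mem _ hs ht
    have h2 := h1 t
    rwa [ht, TensorProduct.rid_tmul] at h2
  · have h1 : ∀ c ∈ (J • ⊤ : Submodule R B),
        (TensorProduct.rid R B).symm c ∈ LinearMap.range (J.subtype.lTensor B) := by
      intro c hc
      induction hc using Submodule.smul_induction_on' with
      | smul j hj b _ =>
        refine ⟨b ⊗ₜ ⟨j, hj⟩, ?_⟩
        rw [LinearEquiv.eq_symm_apply, LinearMap.lTensor_tmul, TensorProduct.rid_tmul]
        rfl
      | add x _ y _ hx hy => rw [map_add]; exact Submodule.add_mem _ hx hy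
    have h2 := h1 _ h
    rwa [map_smul, TensorProduct.rid_symm_apply, ← TensorProduct.tmul_smul, smul_eq_mul,
      mul_one] at h2

/-- Over a Noetherian local ring, regular sequences in the maximal ideal may be permuted: move an
element last, where taking a power is harmless, then move it back among the finished ones. -/
theorem IsWeaklyRegular.map_pow_right [IsLocalRing R] [IsNoetherianRing R] (s : ℕ) (bs : List R) :
    ∀ as : List R, (∀ x ∈ as ++ bs, x ∈ maximalIdeal R) → 0 < s → IsWeaklyRegular R (as ++ bs) →
      IsWeaklyRegular R (as ++ bs.map (· ^ s)) := by
  induction bs with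
  | nil => intro as _ _ h; simpa using h
  | cons b bs ih =>
    intro as hm hs h
    have h1 : IsWeaklyRegular R ((as ++ bs) ++ [b]) :=
      isWeaklyRegular_of_perm_of_subset_maximalIdeal h
        (by rw [List.append_assoc]; exact (List.perm_append_singleton b bs).symm.append_left as) hm
    have h2 : IsWeaklyRegular R ((as ++ bs) ++ [b ^ s]) := by
      rw [isWeaklyRegular_append_iff] at h1 ⊢
      refine ⟨h1.1, ?_⟩
      rw [isWeaklyRegular_singleton_iff] at h1 ⊢
      exact h1.2.pow s
    have hm' : ∀ x ∈ (as ++ bs) ++ [b ^ s], x ∈ maximalIdeal R := by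
      intro x hx
      simp only [List.mem_append, List.mem_singleton] at hx
      rcases hx with (hx | hx) | rfl
      · exact hm x (by simp [hx])
      · exact hm x (by simp [hx])
      · exact Ideal.pow_mem_of_mem _ (hm b (by simp)) s hs
    have h3 : ((as ++ bs) ++ [b ^ s]).Perm ((as ++ [b ^ s]) ++ bs) := by
      rw [List.append_assoc, List.append_assoc]
      exact List.perm_append_comm.append_left as
    have h4 := ih (as ++ [b ^ s]) (fun x hx => hm' x (h3.mem_iff.2 hx)) hs
      (isWeaklyRegular_of_perm_of_subset_maximalIdeal h2 h3 hm')
    simpa using h4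

variable [IsLocalRing R]

theorem IsSystemOfParameters.mem_maximalIdeal {xs : List R} (h : IsSystemOfParameters xs) {x : R}
    (hx : x ∈ xs) : x ∈ maximalIdeal R := by
  rw [← h.2]
  exact Ideal.le_radical (Ideal.subset_span hx)

theorem IsSystemOfParameters.of_forall_exists_pow_mem {xs ys : List R}
    (h : IsSystemOfParameters xs) (hlen : ys.length = xs.length)
    (hys : ∀ y ∈ ys, y ∈ maximalIdeal R) (hxs : ∀ x ∈ xs, ∃ s, x ^ s ∈ Ideal.ofList ys) :
    IsSystemOfParameters ys := by
  refine ⟨hlen ▸ h.1, le_antisymm ?_ ?_⟩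
  · exact (maximalIdeal.isMaximal R).isPrime.radical_le_iff.2 (Ideal.span_le.2 hys)
  · rw [← h.2]
    exact Ideal.radical_le_radical_iff.2 (Ideal.span_le.2 hxs)

theorem IsSystemOfParameters.of_perm {xs ys : List R}
    (h : IsSystemOfParameters xs) (hp : xs.Perm ys) : IsSystemOfParameters ys :=
  h.of_forall_exists_pow_mem hp.length_eq.symm (fun _ hy => h.mem_maximalIdeal (hp.mem_iff.2 hy))
    fun x hx => ⟨1, by rw [pow_one]; exact Ideal.subset_span (hp.mem_iff.1 hx)⟩

theorem IsSystemOfParameters.map_pow_append {xs ys : List R} {s : ℕ} (hs : 0 < s)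
    (h : IsSystemOfParameters (xs ++ ys)) : IsSystemOfParameters (xs.map (· ^ s) ++ ys) := by
  refine h.of_forall_exists_pow_mem (by simp) (fun y hy => ?_) fun x hx => ?_
  · rw [List.mem_append, List.mem_map] at hy
    rcases hy with ⟨x, hx, rfl⟩ | hy
    · exact Ideal.pow_mem_of_mem _ (h.mem_maximalIdeal (by simp [hx])) s hs
    · exact h.mem_maximalIdeal (by simp [hy])
  · rw [List.mem_append] at hx
    rcases hx with hx | hx
    · refine ⟨s, Ideal.subset_span ?_⟩
      change _ ∈ xs.map (· ^ s) ++ ys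
      rw [List.mem_append, List.mem_map]
      exact Or.inl ⟨x, hx, rfl⟩
    · refine ⟨1, Ideal.subset_span ?_⟩
      change _ ∈ xs.map (· ^ s) ++ ys
      rw [pow_one, List.mem_append]
      exact Or.inr hx

variable {B : Type v} [AddCommGroup B] [Module R B]

theorem IsBigCohenMacaulay.mem_of_smul_mem (hB : IsBigCohenMacaulay R B) {xs ys : List R} {x : R}
    (h : IsSystemOfParameters (xs ++ x :: ys)) {b : B}
    (hb : x • b ∈ (Ideal.ofList xs • ⊤ : Submodule R B)) :
    b ∈ (Ideal.ofList xs • ⊤ : Submodule R B) := by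
  have h1 := ((isWeaklyRegular_append_iff B xs (x :: ys)).1 (hB _ h).toIsWeaklyRegular).2
  have h2 := ((isWeaklyRegular_cons_iff _ _ _).1 h1).1
  rw [← Submodule.Quotient.mk_eq_zero] at hb ⊢
  rw [Submodule.Quotient.mk_smul] at hb
  exact h2 (hb.trans (smul_zero x).symm)

/-- Remove one parameter at a time: if y^s(pb − yc) lies in the ideal of the other elements times B,
cancel y^s, which is regular modulo them. So pb lies in that submodule plus yB, and `y` joins `zs`.
-/
theorem IsBigCohenMacaulay.mem_of_prod_pow_smul_mem (hB : IsBigCohenMacaulay R B) (s : ℕ)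
    (ys : List R) : ∀ (zs : List R), IsSystemOfParameters (ys ++ zs) → ∀ b : B,
      (ys.map (· ^ s)).prod • b ∈
        (Ideal.ofList (ys.map (· ^ (s + 1)) ++ zs) • ⊤ : Submodule R B) →
      b ∈ (Ideal.ofList (ys ++ zs) • ⊤ : Submodule R B) := by
  induction ys with
  | nil => intro zs _ b hb; simpa using hb
  | cons y ys ih =>
    intro zs h b hb
    have hp : (y :: ys ++ zs).Perm (ys ++ y :: zs) := List.perm_middle.symm
    have hsop : IsSystemOfParameters ((ys.map (· ^ (s + 1)) ++ zs) ++ [y]) := by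
      refine ((h.of_perm hp).map_pow_append s.succ_pos).of_perm ?_
      rw [List.append_assoc]
      exact (List.perm_append_singleton y zs).symm.append_left _
    have hJ : (Ideal.ofList (ys ++ y :: zs) • ⊤ : Submodule R B) =
        (Ideal.ofList (y :: ys ++ zs) • ⊤ : Submodule R B) := by
      rw [show Ideal.ofList (ys ++ y :: zs) = Ideal.ofList (y :: ys ++ zs) from
        congrArg Ideal.span (Set.ext fun _ => hp.symm.mem_iff)]
    rw [← hJ]
    refine ih (y :: zs) (h.of_perm hp) b ?_
    rw [List.map_cons, List.map_cons, List.prod_cons, mul_smul, List.cons_append,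
      Ideal.ofList_cons_smul] at hb
    obtain ⟨c, hc, e, he, hce⟩ := Submodule.mem_sup.1 hb
    obtain ⟨c', -, rfl⟩ := (Submodule.mem_smul_pointwise_iff_exists _ _ _).1 hc
    have h1 : y ^ s • ((ys.map (· ^ s)).prod • b - y • c') ∈
        (Ideal.ofList (ys.map (· ^ (s + 1)) ++ zs) • ⊤ : Submodule R B) := by
      rw [smul_sub, ← hce, smul_smul, ← pow_succ, add_sub_cancel_left]
      exact he
    have h2 : ∀ n : ℕ, ∀ b : B, y ^ n • b ∈
        (Ideal.ofList (ys.map (· ^ (s + 1)) ++ zs) • ⊤ : Submodule R B) →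
        b ∈ (Ideal.ofList (ys.map (· ^ (s + 1)) ++ zs) • ⊤ : Submodule R B) := by
      intro n
      induction n with
      | zero => intro b hb; simpa using hb
      | succ n ihn =>
        intro b hb
        rw [pow_succ, mul_smul] at hb
        exact hB.mem_of_smul_mem hsop (ihn _ hb)
    have h3 : (Ideal.ofList (ys.map (· ^ (s + 1)) ++ zs) • ⊤ : Submodule R B) ≤
        (Ideal.ofList (ys.map (· ^ (s + 1)) ++ y :: zs) • ⊤ : Submodule R B) := by
      refine Submodule.smul_mono_left (Ideal.span_mono fun a ha => ?_)
      simp only [Set.mem_ofPred_eq, List.mem_append, List.mem_cons] at ha ⊢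
      tauto
    have h4 := Submodule.add_mem _ (h3 (h2 s _ h1)) (Submodule.smul_mem_smul
      (I := Ideal.ofList (ys.map (· ^ (s + 1)) ++ y :: zs)) (r := y) (n := c')
      (Ideal.subset_span (by simp)) trivial)
    rwa [sub_add_cancel] at h4

/-- Let r be in the closure C of (ys). Closedness of (ys, z) gives r = j + az, and regularity of z
on B/(ys)B puts a in C. Hence C ⊆ (ys) + mC, and Nakayama applies. -/
theorem IsBigCohenMacaulay.closed_of_closed_append [IsNoetherianRing R]
    (hB : IsBigCohenMacaulay R B) (zs : List R) : ∀ ys : List R,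
      IsSystemOfParameters (ys ++ zs) →
      moduleClosureSubmodule B (Ideal.ofList (ys ++ zs)) ≤ Ideal.ofList (ys ++ zs) →
      moduleClosureSubmodule B (Ideal.ofList ys) ≤ Ideal.ofList ys := by
  induction zs with
  | nil => intro ys _ h; simpa using h
  | cons z zs ih =>
    intro ys h hcl
    have h1 : moduleClosureSubmodule B (Ideal.ofList (ys ++ [z])) ≤ Ideal.ofList (ys ++ [z]) :=
      ih (ys ++ [z]) (by simpa using h) (by simpa using hcl)
    have hle : moduleClosureSubmodule B (Ideal.ofList ys) ≤
        moduleClosureSubmodule B (Ideal.ofList (ys ++ [z])) :=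
      (moduleClosure R B).cl_mono (Ideal.span_mono fun a ha => List.mem_append_left _ ha)
    have hz : z ∈ maximalIdeal R := h.mem_maximalIdeal (by simp)
    refine Submodule.le_of_le_smul_of_le_jacobson_bot (I := maximalIdeal R)
      (IsNoetherian.noetherian _) (maximalIdeal_le_jacobson _) fun r hr => ?_
    have hr1 := h1 (hle hr)
    rw [Ideal.ofList_append, Ideal.ofList_singleton] at hr1
    obtain ⟨j, hj, c, hc, rfl⟩ := Submodule.mem_sup.1 hr1
    obtain ⟨a, rfl⟩ := Ideal.mem_span_singleton'.1 hc
    refine Submodule.mem_sup.2 ⟨j, hj, a * z, ?_, rfl⟩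
    rw [mul_comm]
    refine Submodule.smul_mem_smul hz ?_
    rw [mem_moduleClosureSubmodule_ideal] at hr ⊢
    intro b
    refine hB.mem_of_smul_mem h (x := z) ?_
    have h2 := Submodule.sub_mem _ (hr b) (Submodule.smul_mem_smul (n := b) hj trivial)
    rwa [← sub_smul, add_sub_cancel_left, mul_comm, mul_smul] at h2

/-- If x_i r ∈ (x_j : j < i), regularity on B puts rb in (x_j : j < i)B for every b. So r is in the
closure of that ideal, which is closed. -/
theorem IsBigCohenMacaulay.isWeaklyRegular_of_closed [IsNoetherianRing R]
    (hB : IsBigCohenMacaulay R B) {xs : List R} (h : IsSystemOfParameters xs)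
    (hcl : moduleClosureSubmodule B (Ideal.ofList xs) ≤ Ideal.ofList xs) :
    IsWeaklyRegular R xs := by
  refine ⟨fun i hi => ?_⟩
  have hsplit : xs.take i ++ xs[i] :: xs.drop (i + 1) = xs := by
    rw [← List.drop_eq_getElem_cons hi, List.take_append_drop]
  have hcl' := hB.closed_of_closed_append (xs.drop i) (xs.take i)
    (by rwa [List.take_append_drop]) (by rwa [List.take_append_drop])
  rw [isSMulRegular_iff_right_eq_zero_of_smul]
  intro m hm
  obtain ⟨r, rfl⟩ := Submodule.Quotient.mk_surjective _ m
  rw [← Submodule.Quotient.mk_smul, Submodule.Quotient.mk_eq_zero, smul_eq_mul, smul_eq_mul,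
    Ideal.mul_top] at hm
  rw [Submodule.Quotient.mk_eq_zero, smul_eq_mul, Ideal.mul_top]
  refine hcl' (mem_moduleClosureSubmodule_ideal.2 fun b => ?_)
  refine hB.mem_of_smul_mem (x := xs[i]) (ys := xs.drop (i + 1)) (hsplit.symm ▸ h) ?_
  rw [← mul_smul]
  exact Submodule.smul_mem_smul hm trivial

end BigCohenMacaulay

/-! ### The closure of zero in top local cohomology, and the theorem -/

section ClRational

open RingTheory.Sequence IsLocalRing

variable {R : Type u} [CommRing R]

theorem smul_mem_of_tmul_mk_eq_zero {B : Type v} [AddCommGroup B] [Module R B] {J : Ideal R}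
    {b : B} {c : R} (h : b ⊗ₜ[R] (Ideal.Quotient.mk J c) = (0 : B ⊗[R] (R ⧸ J))) :
    c • b ∈ (J • ⊤ : Submodule R B) := by
  have h1 := congrArg (TensorProduct.tensorQuotEquivQuotSMul B J) h
  rw [map_zero] at h1
  rw [← Submodule.Quotient.mk_eq_zero, ← h1]
  exact (TensorProduct.tensorQuotEquivQuotSMul_tmul_mk (M := B) J b c).symm

theorem tmul_mk_eq_zero_of_smul_mem {B : Type v} [AddCommGroup B] [Module R B] {J : Ideal R}
    {b : B} {c : R} (h : c • b ∈ (J • ⊤ : Submodule R B)) :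
    b ⊗ₜ[R] (Ideal.Quotient.mk J c) = (0 : B ⊗[R] (R ⧸ J)) := by
  apply (TensorProduct.tensorQuotEquivQuotSMul B J).injective
  rw [map_zero]
  exact (TensorProduct.tensorQuotEquivQuotSMul_tmul_mk (M := B) J b c).trans
    ((Submodule.Quotient.mk_eq_zero _).2 h)

theorem mem_moduleClosureSubmodule_bot {B : Type v} [AddCommGroup B] [Module R B]
    {M : Type u} [AddCommGroup M] [Module R M] {η : M} :
    η ∈ moduleClosureSubmodule B (⊥ : Submodule R M) ↔ ∀ b : B, b ⊗ₜ[R] η = 0 := by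
  refine forall_congr' fun b => ⟨?_, fun h => h ▸ Submodule.zero_mem _⟩
  rintro ⟨t, ht⟩
  have : (⊥ : Submodule R M).subtype = 0 := by
    ext x
    exact (Submodule.mem_bot R).1 x.2
  rw [this, LinearMap.lTensor_zero, LinearMap.zero_apply] at ht
  exact ht.symm

theorem exists_fg_tmul_eq_zero {B P : Type*} [AddCommGroup B] [Module R B] [AddCommGroup P]
    [Module R P] {b : B} {η : P} (h : b ⊗ₜ[R] η = 0) :
    ∃ (N : Submodule R P) (_ : N.FG) (hη : η ∈ N), b ⊗ₜ[R] (⟨η, hη⟩ : N) = 0 := by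
  have h1 := congrArg (TensorProduct.comm R B P) h
  rw [map_zero, TensorProduct.comm_tmul] at h1
  have hmem := Submodule.mem_span_singleton_self (R := R) η
  obtain ⟨N, hN, hle, h2⟩ := (Submodule.fg_span_singleton (R := R) η).exists_rTensor_fg_inclusion_eq
    (M := B) (x := (⟨η, hmem⟩ : Submodule.span R {η}) ⊗ₜ[R] b) (y := 0)
    (by rw [map_zero, LinearMap.rTensor_tmul]; exact h1)
  refine ⟨N, hN, hle hmem, ?_⟩
  rw [map_zero, LinearMap.rTensor_tmul] at h2
  have h3 := congrArg (TensorProduct.comm R N B) h2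
  rwa [map_zero, TensorProduct.comm_tmul] at h3

theorem exists_pow_forall_smul_eq_zero {I : Ideal R} {P : Type*} [AddCommGroup P] [Module R P]
    (hP : ∀ η : P, ∃ t, ∀ r ∈ I ^ t, r • η = 0) {N : Submodule R P} (hN : N.FG) :
    ∃ t, ∀ η ∈ N, ∀ r ∈ I ^ t, r • η = 0 := by
  induction N, hN using Submodule.fg_induction with
  | singleton η =>
    obtain ⟨t, ht⟩ := hP η
    refine ⟨t, fun ζ hζ r hr => ?_⟩
    obtain ⟨a, rfl⟩ := Submodule.mem_span_singleton.1 hζ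
    rw [smul_comm, ht r hr, smul_zero]
  | sup N₁ N₂ _ _ h₁ h₂ =>
    obtain ⟨t₁, h₁⟩ := h₁
    obtain ⟨t₂, h₂⟩ := h₂
    refine ⟨max t₁ t₂, fun η hη r hr => ?_⟩
    obtain ⟨y, hy, z, hz, rfl⟩ := Submodule.mem_sup.1 hη
    rw [smul_add, h₁ y hy r (Ideal.pow_le_pow_right (le_max_left _ _) hr),
      h₂ z hz r (Ideal.pow_le_pow_right (le_max_right _ _) hr), add_zero]

theorem mul_prod_pow_mem {xs : List R} (t : ℕ) {k : R} (hk : k ∈ Ideal.ofList xs) :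
    k * (xs.map (· ^ t)).prod ∈ Ideal.ofList (xs.map (· ^ (t + 1))) := by
  have : Ideal.ofList xs ≤ Submodule.comap (LinearMap.mulRight R (xs.map (· ^ t)).prod)
      (Ideal.ofList (xs.map (· ^ (t + 1)))) := by
    refine Ideal.span_le.2 fun x hx => ?_
    change x * (xs.map (· ^ t)).prod ∈ Ideal.ofList (xs.map (· ^ (t + 1)))
    have h1 : x ^ t ∣ (xs.map (· ^ t)).prod := List.dvd_prod (List.mem_map.2 ⟨x, hx, rfl⟩)
    refine Ideal.mem_of_dvd _ (pow_succ' x t ▸ mul_dvd_mul_left x h1) (Ideal.subset_span ?_)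
    exact List.mem_map.2 ⟨x, hx, rfl⟩
  exact this hk

variable [IsLocalRing R]

/-- If η ≠ 0, its annihilator lies in the maximal ideal, so Rη maps onto k ⊆ E with η ↦ 1;
injectivity of E extends this map to M. -/
theorem IsInjectiveHullOfResidueField.eq_zero_of_forall {E : Type u} [AddCommGroup E] [Module R E]
    (hE : IsInjectiveHullOfResidueField R E) {M : Type u} [AddCommGroup M] [Module R M] {η : M}
    (h : ∀ f : M →ₗ[R] E, f η = 0) : η = 0 := by
  by_contra hη
  obtain ⟨i, hi, -⟩ := hE.essential
  let g : R →ₗ[R] M := LinearMap.toSpanSingleton R M η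
  have hg : LinearMap.ker g ≤ maximalIdeal R := by
    refine le_maximalIdeal fun htop => hη ?_
    have : (1 : R) ∈ LinearMap.ker g := htop ▸ Submodule.mem_top
    rwa [LinearMap.mem_ker, LinearMap.toSpanSingleton_apply, one_smul] at this
  have hk : LinearMap.ker g ≤ LinearMap.ker (i ∘ₗ Algebra.linearMap R (ResidueField R)) := by
    intro r hr
    rw [LinearMap.mem_ker, LinearMap.comp_apply, Algebra.linearMap_apply,
      ResidueField.algebraMap_eq, (residue_eq_zero_iff r).2 (hg hr), map_zero]
  obtain ⟨f, hf⟩ := hE.injective.out ((LinearMap.ker g).liftQ g le_rfl)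
    (LinearMap.ker_eq_bot.1 (Submodule.ker_liftQ_eq_bot _ _ _ le_rfl)) ((LinearMap.ker g).liftQ _ hk)
  have h1 : f (g 1) = i (algebraMap R (ResidueField R) 1) := hf (Submodule.Quotient.mk 1)
  have h2 : f η = i 1 := by rwa [LinearMap.toSpanSingleton_apply, one_smul, map_one] at h1
  rw [h] at h2
  exact one_ne_zero (hi (h2.symm.trans (map_zero i).symm))

theorem testSubmodule_eq_top_iff {E : Type u} [AddCommGroup E] [Module R E]
    (hE : IsInjectiveHullOfResidueField R E) {ω : Type u} [AddCommGroup ω] [Module R ω]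
    (ψ : CanonicalModuleIso R E ω) (c : ModuleClosureOperation R) :
    testSubmodule c ψ = ⊤ ↔ c.cl (⊥ : Submodule R (TopLocalCohomology R)) = ⊥ := by
  constructor
  · intro h
    rw [Submodule.eq_bot_iff]
    intro η hη
    refine hE.eq_zero_of_forall fun f => ?_
    have h1 : ψ.symm f ∈ testSubmodule c ψ := h ▸ Submodule.mem_top
    have h2 : ψ (ψ.symm f) η = 0 := h1 η hη
    rwa [LinearEquiv.apply_symm_apply] at h2
  · intro h
    rw [Submodule.eq_top_iff']
    intro w η hη
    rw [h, Submodule.mem_bot] at hη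
    rw [hη, map_zero]

variable [IsNoetherianRing R]

/-- Dividing by a regular sequence lowers the dimension by its length, here to 0. So every minimal
prime over (xs) is maximal, and the radical is m. -/
theorem exists_isSystemOfParameters_of_isCohenMacaulayLocal (h : IsCohenMacaulayLocal R) :
    ∃ xs : List R, IsSystemOfParameters xs ∧ IsWeaklyRegular R xs := by
  obtain ⟨xs, hm, hlen, hreg⟩ := h
  refine ⟨xs, ⟨hlen, ?_⟩, hreg.toIsWeaklyRegular⟩
  have h1 := ringKrullDim_add_length_eq_ringKrullDim_of_isRegular xs hreg
  have hle : Ideal.ofList xs ≤ maximalIdeal R := Ideal.span_le.2 hm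
  have h2 : ringKrullDim (R ⧸ Ideal.ofList xs) ≤ 0 := by
    rw [← hlen] at h1
    have hb : ringKrullDim (R ⧸ Ideal.ofList xs) ≠ ⊥ := by
      intro hb
      rw [hb] at h1
      simp at h1
    obtain ⟨e, he⟩ := WithBot.ne_bot_iff_exists.1 hb
    rw [← he] at h1 ⊢
    have h3 : e + (xs.length : ℕ∞) = xs.length := by exact_mod_cast h1
    have h4 : e = 0 := by
      induction e using ENat.recTopCoe with
      | top => exact absurd h3 (by simp)
      | coe e =>
        have h5 : e + xs.length = xs.length := by exact_mod_cast h3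
        have h6 : e = 0 := by omega
        exact_mod_cast h6
    rw [h4]
    rfl
  have h3 : Ring.KrullDimLE 0 (R ⧸ Ideal.ofList xs) := Ring.krullDimLE_iff.2 (by exact_mod_cast h2)
  rw [Ideal.krullDimLE_zero_quotient_iff_forall_minimalPrimes_isMaximal] at h3
  refine le_antisymm ((maximalIdeal.isMaximal R).isPrime.radical_le_iff.2 hle) ?_
  rw [← Ideal.sInf_minimalPrimes]
  exact le_sInf fun J hJ => (eq_maximalIdeal (h3 J hJ)).ge

theorem exists_quotient_to_topLocalCohomology {xs : List R} (h : IsSystemOfParameters xs)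
    (hreg : IsWeaklyRegular R xs) :
    ∃ u : (R ⧸ Ideal.ofList xs) →ₗ[R] TopLocalCohomology R, Function.Injective u ∧
      ∀ η, (∃ a, u a = η) ↔ ∀ k ∈ Ideal.ofList xs, k • η = 0 := by
  have hd : xs.length = ((ringKrullDim R).unbotD 0).toNat := by
    rw [← h.1]
    rfl
  obtain ⟨t, ht⟩ := Ideal.exists_radical_pow_le_of_fg (Ideal.ofList xs)
    (IsNoetherian.noetherian _)
  rw [h.2] at ht
  refine exists_quotient_to_localCohomology (maximalIdeal R) _ (fun s => ?_) hreg hd ht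
  -- The exponent is s + 1 so that it is positive even for s = 0.
  refine ⟨xs.map (· ^ (s + 1)), ?_, by rw [List.length_map, hd], Ideal.span_le.2 fun y hy => ?_⟩
  · exact IsWeaklyRegular.map_pow_right (s + 1) xs [] (fun x hx => h.mem_maximalIdeal hx) s.succ_pos
      hreg
  · obtain ⟨x, hx, rfl⟩ := List.mem_map.1 hy
    exact Ideal.pow_le_pow_right s.le_succ (Ideal.pow_mem_pow (h.mem_maximalIdeal hx) _)

variable {B : Type v} [AddCommGroup B] [Module R B]

theorem closure_ofList_le_of_closure_bot_eq_bot {xs : List R} (h : IsSystemOfParameters xs)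
    (hreg : IsWeaklyRegular R xs)
    (hcl : moduleClosureSubmodule B (⊥ : Submodule R (TopLocalCohomology R)) = ⊥) :
    moduleClosureSubmodule B (Ideal.ofList xs) ≤ Ideal.ofList xs := by
  obtain ⟨u, hu, -⟩ := exists_quotient_to_topLocalCohomology h hreg
  intro r hr
  rw [mem_moduleClosureSubmodule_ideal] at hr
  have h1 : u (Ideal.Quotient.mk _ r) ∈
      moduleClosureSubmodule B (⊥ : Submodule R (TopLocalCohomology R)) := by
    rw [mem_moduleClosureSubmodule_bot]
    intro b
    rw [← LinearMap.lTensor_tmul, tmul_mk_eq_zero_of_smul_mem (hr b), map_zero]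
  rw [hcl, Submodule.mem_bot, map_eq_zero_iff u hu] at h1
  exact Ideal.Quotient.eq_zero_iff_mem.1 h1

theorem IsBigCohenMacaulay.eq_zero_of_mem_closure_bot (hB : IsBigCohenMacaulay R B) {xs : List R}
    (h : IsSystemOfParameters xs) (hreg : IsWeaklyRegular R xs)
    (hcl : moduleClosureSubmodule B (Ideal.ofList xs) ≤ Ideal.ofList xs)
    {η : TopLocalCohomology R} (hη : ∀ b : B, b ⊗ₜ[R] η = 0)
    (hk : ∀ k ∈ Ideal.ofList xs, k • η = 0) : η = 0 := by
  obtain ⟨u, hu, hu'⟩ := exists_quotient_to_topLocalCohomology h hreg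
  obtain ⟨a, rfl⟩ := (hu' η).2 hk
  obtain ⟨r, rfl⟩ := Ideal.Quotient.mk_surjective a
  refine (map_eq_zero_iff u hu).2 (Ideal.Quotient.eq_zero_iff_mem.2 (hcl ?_))
  rw [mem_moduleClosureSubmodule_ideal]
  intro b
  obtain ⟨N, hN, hηN, hb⟩ := exists_fg_tmul_eq_zero (hη b)
  obtain ⟨t, ht⟩ := exists_pow_forall_smul_eq_zero
    (exists_pow_smul_eq_zero (maximalIdeal R) _ (ModuleCat.of R R)) hN
  have hJ : IsSystemOfParameters (xs.map (· ^ (t + 1))) := by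
    have := (show IsSystemOfParameters (xs ++ []) by rwa [List.append_nil]).map_pow_append t.succ_pos
    rwa [List.append_nil] at this
  have hJreg : IsWeaklyRegular R (xs.map (· ^ (t + 1))) :=
    IsWeaklyRegular.map_pow_right (t + 1) xs [] (fun x hx => h.mem_maximalIdeal hx) t.succ_pos hreg
  have hJt : Ideal.ofList (xs.map (· ^ (t + 1))) ≤ maximalIdeal R ^ t := by
    refine Ideal.span_le.2 fun y hy => ?_
    obtain ⟨x, hx, rfl⟩ := List.mem_map.1 hy
    exact Ideal.pow_le_pow_right t.le_succ (Ideal.pow_mem_pow (h.mem_maximalIdeal hx) _)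
  have hJK : Ideal.ofList (xs.map (· ^ (t + 1))) ≤ Ideal.ofList xs := by
    refine Ideal.span_le.2 fun y hy => ?_
    obtain ⟨x, hx, rfl⟩ := List.mem_map.1 hy
    exact Ideal.pow_mem_of_mem _ (show x ∈ Ideal.ofList xs from Ideal.subset_span hx) _ t.succ_pos
  obtain ⟨v, hv, hv'⟩ := exists_quotient_to_topLocalCohomology hJ hJreg
  -- The inclusion of the two copies R/(xs) and R/(x_i^{t+1}) in H becomes multiplication by `d`.
  -- The classical value d = (x_1⋯x_d)^t is not needed: it is enough that this product is a multiple
  -- of `d` modulo (x_i^{t+1}), as shown below.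
  obtain ⟨d, hd⟩ := (hv' (u (Ideal.Quotient.mk _ 1))).2 fun k hk =>
    (hu' _).1 ⟨_, rfl⟩ k (hJK hk)
  obtain ⟨d, rfl⟩ := Ideal.Quotient.mk_surjective d
  have key : ∀ s : R, u (Ideal.Quotient.mk _ s) = v (Ideal.Quotient.mk _ (s * d)) := by
    intro s
    have h1 : u (Ideal.Quotient.mk _ s) = s • u (Ideal.Quotient.mk _ 1) := by
      rw [← map_smul]
      congr 1
      rw [Algebra.smul_def, map_one, mul_one]
      rfl
    rw [h1, ← hd, ← map_smul]
    congr 1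
  -- `N` lies in the copy of R/(x_i^{t+1}), so b ⊗ η = 0 in B ⊗ N carries over to B ⊗ R/(x_i^{t+1}).
  have hrd : (r * d) • b ∈ (Ideal.ofList (xs.map (· ^ (t + 1))) • ⊤ : Submodule R B) := by
    let e := LinearEquiv.ofInjective v hv
    have hNv : N ≤ LinearMap.range v := fun ζ hζ =>
      (hv' ζ).2 fun k hk => ht ζ hζ k (hJt hk)
    have h1 := congrArg ((e.symm.toLinearMap ∘ₗ Submodule.inclusion hNv).lTensor B) hb
    rw [map_zero, LinearMap.lTensor_tmul] at h1
    refine smul_mem_of_tmul_mk_eq_zero (h1 ▸ ?_)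
    congr 1
    rw [LinearMap.comp_apply]
    change _ = e.symm _
    rw [LinearEquiv.eq_symm_apply]
    exact Subtype.ext (key r).symm
  -- The class of the product in R/(x_i^{t+1}) is killed by (xs), hence comes from R/(xs): the
  -- product is ad modulo (x_i^{t+1}).
  obtain ⟨a, ha⟩ := (hu' (v (Ideal.Quotient.mk _ (xs.map (· ^ t)).prod))).2 fun k hk => by
    rw [← map_smul, map_eq_zero_iff v hv, Algebra.smul_def]
    exact Ideal.Quotient.eq_zero_iff_mem.2 (mul_prod_pow_mem t hk)
  obtain ⟨a, rfl⟩ := Ideal.Quotient.mk_surjective a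
  rw [key] at ha
  have ha' := Ideal.Quotient.eq.1 (hv ha).symm
  have h2 : (xs.map (· ^ t)).prod • r • b ∈
      (Ideal.ofList (xs.map (· ^ (t + 1)) ++ []) • ⊤ : Submodule R B) := by
    rw [List.append_nil]
    have h3 := Submodule.add_mem _ (Submodule.smul_mem_smul (N := (⊤ : Submodule R B))
      (n := r • b) ha' trivial)
      (Submodule.smul_mem _ a hrd)
    have h4 : ((xs.map (· ^ t)).prod - a * d) • r • b + a • (r * d) • b =
        (xs.map (· ^ t)).prod • r • b := by
      rw [sub_smul, smul_smul, smul_smul, smul_smul, show a * d * r = a * (r * d) by ring,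
        sub_add_cancel]
    rwa [h4] at h3
  have h5 := hB.mem_of_prod_pow_smul_mem t xs [] (by rwa [List.append_nil]) (r • b) h2
  rwa [List.append_nil] at h5

theorem IsBigCohenMacaulay.closure_bot_eq_bot_of_closed (hB : IsBigCohenMacaulay R B)
    {xs : List R} (h : IsSystemOfParameters xs) (hreg : IsWeaklyRegular R xs)
    (hcl : moduleClosureSubmodule B (Ideal.ofList xs) ≤ Ideal.ofList xs) :
    moduleClosureSubmodule B (⊥ : Submodule R (TopLocalCohomology R)) = ⊥ := by
  rw [Submodule.eq_bot_iff]
  intro η hη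
  obtain ⟨t, ht⟩ := exists_pow_smul_eq_zero (maximalIdeal R) _ (ModuleCat.of R R) η
  induction t generalizing η with
  | zero => simpa using ht 1 (by simp)
  | succ t ih =>
    -- For r ∈ m^t, rη is still in the closure of zero and is killed by (xs) ⊆ m, so it vanishes;
    -- thus m^t already kills η.
    refine ih η hη fun r hr => ?_
    have h1 := Submodule.smul_mem _ r hη
    rw [mem_moduleClosureSubmodule_bot] at h1
    refine hB.eq_zero_of_mem_closure_bot h hreg hcl h1 fun k hk => ?_
    rw [smul_smul]
    refine ht _ ?_
    rw [pow_succ']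
    exact Ideal.mul_mem_mul (Ideal.span_le.2 (fun x hx => h.mem_maximalIdeal hx) hk) hr

end ClRational

theorem mainTheorem8 {R : Type u} [CommRing R] [IsLocalRing R] [IsNoetherianRing R]
    [IsAdicComplete (IsLocalRing.maximalIdeal R) R]
    {E : Type u} [AddCommGroup E] [Module R E] (hE : IsInjectiveHullOfResidueField R E)
    {ω : Type u} [AddCommGroup ω] [Module R ω] (ψ : CanonicalModuleIso R E ω)
    {B : Type v} [AddCommGroup B] [Module R B] (hB : IsBigCohenMacaulay R B) :
    IsClRational (moduleClosure R B) ψ ↔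
      ∃ xs : List R, IsSystemOfParameters xs ∧
        (moduleClosure R B).cl (Ideal.ofList xs) = Ideal.ofList xs := by
  rw [IsClRational, testSubmodule_eq_top_iff hE]
  constructor
  · rintro ⟨hCM, hcl⟩
    obtain ⟨xs, hxs, hreg⟩ := exists_isSystemOfParameters_of_isCohenMacaulayLocal hCM
    exact ⟨xs, hxs, le_antisymm (closure_ofList_le_of_closure_bot_eq_bot hxs hreg hcl)
      (moduleClosureSubmodule_le B _)⟩
  · rintro ⟨xs, hxs, hcl⟩
    have hreg := hB.isWeaklyRegular_of_closed hxs hcl.le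
    have hm : ∀ x ∈ xs, x ∈ IsLocalRing.maximalIdeal R := fun x hx => hxs.mem_maximalIdeal hx
    exact ⟨⟨xs, hm, hxs.1, .of_isWeaklyRegular_of_mem_maximalIdeal R hm hreg⟩,
      hB.closure_bot_eq_bot_of_closed hxs hreg hcl.le⟩
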